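/- **Setting.** Let $\Omega\subset\mathbb R^3$ be a bounded domain with convex closure and $C^{1,\alpha}$ boundary for some $0<\alpha\le1$, with exterior unit normal $n=(n_1,n_2,n_3)$ and surface measure $dS$. Let $T,\mu,\rho>0$, $\tau=1/\rho$, $Q=\overline\Omega\times[0,T]\subset\mathbb R^4$, $F\in C(Q;\mathbb R^3)$ and $A_1\in C^2(\overline\Omega;\mathbb R^3)$. Consider the Navier–Stokes problem $\operatorname{div}u=0$, $u_t-\mu\Delta u+(u\cdot\nabla)u+\tau\operatorname{grad}p=F$, $u|_{t=0}=A_1$, with one of the boundary conditions: Dirichlet, $u|_{\partial\Omega}=A_3$ with $A_3$ given, continuous on $\partial\Omega\times[0,T]$ and in $C^2(\partial\Omega)\cap C^1[0,T]$; Neumann, $\partial u/\partial n=A_7$ with $A_7\in C^1(\partial\Omega\times[0,T])$ given; Robin, $\partial u/\partial n+\sigma u=A_8$ with $A_8,\sigma\in C(\partial\Omega\times[0,T])$ given and $\sigma>0$. **Unknown.** $Z_1$ is an $\mathbb R^{33}$-valued function of $X=(x,y,z,t)$ made of the 11 blocks of three components $u$, $(p,\partial_xu_2,\partial_xu_3)$,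 $u_y,u_z,u_{xx},u_{xy},u_{xz},u_{yy},u_{yz},u_{zz},\operatorname{grad}p$, all of them treated as independent functions. Put $u_x:=(-\partial_yu_2-\partial_zu_3,\partial_xu_2,\partial_xu_3)$ and $$\psi(Z_1)=(\mu-1)(u_{xx}+u_{yy}+u_{zz})-u_1u_x-u_2u_y-u_3u_z+F,\qquad \psi_1(Z_1)=-\tau\operatorname{grad}p+\psi(Z_1).$$ **Potentials.** Let $h(x,s)=(2\sqrt{\pi s})^{-3}e^{-|x|^2/4s}$ for $s>0$, $h=0$ for $s\le0$, and $h_2(x)=1/(4\pi|x|)$. For a function $a$ on $\overline\Omega$, $b$ on $\partial\Omega\times[0,T]$, $v$ on $Q$, let $h*a$, $h*_{\partial\Omega}b$, $h*v$ be the potentials at $(M,t)$ obtained by integrating $h(M-P,t)a(P)$ over $\overline\Omega$, $h(M-P,t-s)b(P,s)$ over $\partial\Omega\times[0,T]$, and $h(M-P,t-s)v(P,s)$ over $Q$. Let $\partial_{n_{P_1}}h*_{\partial\Omega}b$ have the kernel $\nabla h(M-P_1,t-s)\cdot n_{P_1}$ ($P_1$ the integration variable), and let $\partial_{n_{P_0}}h*_{\partial\Omega}b$,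 $\partial_{n_{P_0}}h*v$ be the potentials at $P_0\in\partial\Omega$ with kernel $\nabla h(P_0-P_1,t-s)\cdot n_{P_0}$. **Symbols.** Write $\xi=(\xi_1,\xi_2,\xi_3,\xi_0)$, $s_j=i\xi_j$, $\mathcal F f(\xi)=\int_{\mathbb R^4}f\,e^{-i\xi\cdot X}dX$, and $\mathcal F^{-1}$ for its inverse. $B_1(\xi)$ is the $33\times33$ matrix for which the block rows of the linear system $B_1W=R$, with $W$ written in the 11 blocks above and $u_x$ as above, are $$s_0u-u_{xx}-u_{yy}-u_{zz}+\tau\operatorname{grad}p=R_1,\quad s_1u-u_x=R_2,\quad s_2u-u_y=R_3,\quad s_3u-u_z=R_4,$$ $$s_js_ku-u_{x_jx_k}=R_{jk}\ \ ((j,k)=(1,1),(1,2),(1,3),(2,2),(2,3),(3,3)\text{ in this order}),\qquad (s_1,s_2,s_3)\,p-\operatorname{grad}p=R_{11}.$$ $B_2$ is the $33\times3$ matrix with the identity in the first block and zeros below. **Boundary data.** To $Z_1$ are associated the quantities $A_2=u|_{t=T}$, $A_3=u|_{\partial\Omega}$, $A_4,A_5,A_6=u_x,u_y,u_z|_{\partial\Omega}$,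 $A_7=\partial u/\partial n|_{\partial\Omega}$, $A_9=p|_{\partial\Omega}$ by the following requirements. * $A_3,A_7$ are continuous on $\partial\Omega\times[0,T]$ and, on $\partial\Omega\times(0,T]$, in the Dirichlet case $A_3$ is the given one and $\tfrac12A_7=\partial_{n_{P_0}}h*_{\partial\Omega}A_7+g_{02}+\partial_{n_{P_0}}h*\psi_1(Z_1)$, with $g_{02}$ the limit from inside, along the normal, of the normal derivative of $h*A_1+\partial_{n_{P_1}}h*_{\partial\Omega}A_3$; in the Neumann case $A_7$ is the given one and $\tfrac12A_3=\partial_{n_{P_1}}h*_{\partial\Omega}A_3+g_{04}+h*\psi_1(Z_1)$, with $g_{04}$ the limit from inside of $h*A_1+h*_{\partial\Omega}A_7$; in the Robin case $A_7=A_8-\sigma A_3$ and $\tfrac12A_3=-h*_{\partial\Omega}(\sigma A_3)+\partial_{n_{P_1}}h*_{\partial\Omega}A_3+g_{06}+h*\psi_1(Z_1)$, with $g_{06}$ the limit from inside of $h*A_1+h*_{\partial\Omega}A_8$. * $A_2=h*A_1+h*_{\partial\Omega}A_7+\partial_{n_{P_1}}h*_{\partial\Omega}A_3+h*\psi_1(Z_1)$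 at $t=T$, on $\Omega$. * $A_3(\cdot,t)$ is differentiable along $\partial\Omega$, and $A_{j+3}=\partial_{e_j-n_jn}A_3+A_7n_j$ for $j=1,2,3$, where $e_j-n_jn$ is the tangential part of the $j$-th coordinate vector. * $\tfrac12A_9=\psi_3+\int_{\partial\Omega}\Gamma_4(\cdot,P_1)\psi_3(P_1,t)\,dS+C_0$. Here $\psi_2$ is the limit as $\varepsilon\to0$, on $\Omega\times(0,T)$, of the pressure component of $T_{0\varepsilon}(Z_1)$ (defined below) computed with $A_9$ replaced by $0$, and $\psi_3\in C(\partial\Omega\times[0,T])$ is the limit of $\psi_2$ on $\partial\Omega$ from inside for $0<t<T$. $C_0$ is a fixed constant and $\Gamma_4$ is a fixed resolvent kernel for the equation $\tfrac12\varphi=g+K\varphi$ with $K\varphi(P_0)=\int_{\partial\Omega}\nabla h_2(P_0-P_1)\cdot n_{P_1}\varphi(P_1)dS$; that is, $\varphi=2(g+\int\Gamma_4(\cdot,P_1)g(P_1)\,dS)$ is a continuous solution whenever $g\in C(\partial\Omega)$ is orthogonal in $L^2(\partial\Omega)$ to the continuous solutions of the homogeneous transposed equation. **The operators.** Put $$f_0=\int_{\overline\Omega}(A_2e^{-iT\xi_0}-A_1)e^{-i(x\xi_1+y\xi_2+z\xi_3)}dxdydz,\qquad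 f_j=\int_0^T\!\!\int_{\partial\Omega}A_3n_je^{-i\xi\cdot X}dSdt,$$ $$f_{jk}=\int_0^T\!\!\int_{\partial\Omega}A_{j+3}n_ke^{-i\xi\cdot X}dSdt,\qquad g_j=\int_0^T\!\!\int_{\partial\Omega}A_9n_je^{-i\xi\cdot X}dSdt,$$ and let $\beta_1$ be the vector with blocks $-f_0$, $-f_1,-f_2,-f_3$, $-f_{11}-s_1f_1$, $-f_{21}-s_1f_2$, $-f_{31}-s_1f_3$, $-f_{22}-s_2f_2$, $-f_{32}-s_2f_3$, $-f_{33}-s_3f_3$, $-(g_1,g_2,g_3)$. With $\delta_\varepsilon(X)=(\pi\varepsilon)^{-2}e^{-|X|^2/\varepsilon}$, $\varepsilon>0$, put $$w_{1\varepsilon}=\mathcal F^{-1}(\mathcal F(\delta_\varepsilon)B_1^{-1}\beta_1),\quad w_{2\varepsilon}=\mathcal F^{-1}(\mathcal F(\delta_\varepsilon)B_1^{-1}B_2),\quad T_{0\varepsilon}(Z_1)(X)=w_{1\varepsilon}(X)+\int_Qw_{2\varepsilon}(X-Y)\,\psi(Z_1)(Y)\,dY .$$ "$Z_1=T_{0\varepsilon}(Z_1)$"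 means that equality holds on $Q$, for boundary data associated with $Z_1$. For $M>0$ let $$\Omega_M=\{Z_1\in C(Q;\mathbb R^{33}):\ \|Z_1\|_\infty=\max_{1\le i\le33}\max_{X\in Q}|Z_{1,i}(X)|<M\}.$$ **Theorem.** Let $M>0$. Suppose that there are $\varepsilon_k>0$ with $\varepsilon_k\to0$ and $Z_{1\varepsilon_k}\in\Omega_M$ with $Z_{1\varepsilon_k}=T_{0\varepsilon_k}(Z_{1\varepsilon_k})$, $k\ge1$, such that for every $c>0$ there is $d>0$ such that for all $k,l\ge1$ and all $1\le i\le33$ $$m\big(\Omega^+_{k,l,i}(d)\cup\Omega^-_{k,l,i}(d)\big)\le c,$$ where $m$ is the Lebesgue measure on $\mathbb R^4$, $$\Omega^+_{k,l,i}=\{X\in Q:\ Z_{1,i,\varepsilon_k}(X)-Z_{1,i,\varepsilon_l}(X)\ge0\},\qquad \Omega^-_{k,l,i}=\{X\in Q:\ Z_{1,i,\varepsilon_k}(X)-Z_{1,i,\varepsilon_l}(X)<0\},$$ $$\Omega^\pm_{k,l,i}(d)=\{X\in Q:\ \operatorname{dist}(X,\partial\Omega^\pm_{k,l,i})\le d\},$$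 with boundaries and distances taken in $\mathbb R^4$ and $\operatorname{dist}(X,\emptyset)=+\infty$. Then there are $\varepsilon'_k>0$ with $\varepsilon'_k\to0$ and $Z_{1\varepsilon'_k}\in\Omega_M$ with $Z_{1\varepsilon'_k}=T_{0\varepsilon'_k}(Z_{1\varepsilon'_k})$, $k\ge1$, such that $\lim_{k\to\infty}Z_{1\varepsilon'_k}$ exists almost everywhere on $\overline\Omega\times[0,T]$. -/

import Mathlib

open MeasureTheory Set Filter Topology

namespace NavierStokes

noncomputable section

/-- Physical space `ℝ³`, points `P = (x, y, z)`. -/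
abbrev E3 := EuclideanSpace ℝ (Fin 3)

/-- Space-time `ℝ⁴`, points `X = (x, y, z, t)`; dually, frequencies `ξ = (ξ₁, ξ₂, ξ₃, ξ₀)`. -/
abbrev E4 := EuclideanSpace ℝ (Fin 4)

/-- The 33 component indices, as 11 blocks of 3. The unknown `Z₁` consists of the blocks
`0: u`, `1: (p, ∂ₓu₂, ∂ₓu₃)`, `2: u_y`, `3: u_z`, `4: u_xx`, `5: u_xy`, `6: u_xz`, `7: u_yy`,
`8: u_yz`, `9: u_zz`, `10: grad p`. -/
abbrev Idx := Fin 11 × Fin 3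

/-- The space-time point `(P, t)`. -/
def pt (P : E3) (t : ℝ) : E4 := !₂[P 0, P 1, P 2, t]

/-- The spatial part of a space-time point. -/
def spc (X : E4) : E3 := !₂[X 0, X 1, X 2]

/-! ### Geometry of the domain -/

/-- `∂Ω ∈ C^{1,α}`: near each boundary point, `∂Ω` is the graph of a `C^{1,α}` function `φ` of two
of the coordinates (`φ` does not depend on the `j`-th one), with `Ω` on one side of the graph
(the side is given by the sign `s`). -/
def HasC1HolderBoundary (Ω : Set E3) (α : ℝ) : Prop :=
  ∀ P₀ ∈ frontier Ω, ∃ δ > 0, ∃ (j : Fin 3) (s : ℝ) (φ : E3 → ℝ) (C : ℝ),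
    (s = 1 ∨ s = -1) ∧
    (∀ P Q : E3, (∀ i, i ≠ j → P i = Q i) → φ P = φ Q) ∧
    ContDiff ℝ 1 φ ∧
    (∀ P ∈ Metric.ball P₀ δ, ∀ Q ∈ Metric.ball P₀ δ,
      ‖fderiv ℝ φ P - fderiv ℝ φ Q‖ ≤ C * ‖P - Q‖ ^ α) ∧
    ∀ P ∈ Metric.ball P₀ δ,
      (P ∈ frontier Ω ↔ P j = φ P) ∧ (P ∈ Ω ↔ s * (P j - φ P) < 0)

/-- `n` is an exterior unit normal to `Ω` at `P`: `⟨X - P, n⟩ ≤ o(|X - P|)` as `X → P` in `Ω`.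
At a boundary point of a `C¹` domain there is exactly one such vector. -/
def IsOuterNormal (Ω : Set E3) (P n : E3) : Prop :=
  ‖n‖ = 1 ∧ ∀ η > 0, ∀ᶠ X in 𝓝[Ω] P, inner ℝ (X - P) n ≤ η * ‖X - P‖

open Classical in
/-- The exterior unit normal `n_P` to `∂Ω` at `P`. -/
def outerNormal (Ω : Set E3) (P : E3) : E3 :=
  if h : ∃ n, IsOuterNormal Ω P n then h.choose else 0

/-- The surface measure `dS` on `∂Ω` (two-dimensional Hausdorff measure, normalised so that it is
the usual area). -/
def surf (Ω : Set E3) : Measure E3 := (μHE[2] : Measure E3).restrict (frontier Ω)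

/-! ### Problem data -/

/-- The three kinds of boundary data: Dirichlet data `u|_{∂Ω} = A₃`, Neumann data
`∂u/∂n|_{∂Ω} = A₇`, Robin data `(∂u/∂n + σ u)|_{∂Ω} = A₈`. -/
inductive BdryCond where
  | dirichlet (a₃ : E3 → ℝ → Fin 3 → ℝ)
  | neumann (a₇ : E3 → ℝ → Fin 3 → ℝ)
  | robin (a₈ : E3 → ℝ → Fin 3 → ℝ) (σ : E3 → ℝ → ℝ)

/-- Data of an initial boundary value problem for the Navier-Stokes equations
`div u = 0`, `u_t - μ Δu + (u·∇)u + ρ⁻¹ grad p = F` on `closure Ω × [0, T]`.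
The pressure on `∂Ω` is determined only up to the choice of a resolvent kernel `Γ₄` of a singular
Fredholm equation and of an additive constant `C₀`; both are part of the data. -/
structure Data where
  /-- the domain -/
  Ω : Set E3
  /-- the final time -/
  T : ℝ
  /-- the viscosity -/
  μ : ℝ
  /-- the density -/
  ρ : ℝ
  /-- the body force -/
  F : E4 → Fin 3 → ℝ
  /-- the initial velocity -/
  A₁ : E3 → Fin 3 → ℝ
  /-- the boundary condition -/
  bc : BdryCond
  /-- the resolvent kernel used for the boundary pressure -/
  Γ₄ : E3 → E3 → ℝ
  /-- the additive constant in the boundary pressure -/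
  C₀ : ℝ

namespace Data

variable (D : Data)

/-- `τ = 1 / ρ`. -/
def τ : ℝ := 1 / D.ρ

/-- The exterior unit normal to `∂Ω`. -/
def n (P : E3) : E3 := outerNormal D.Ω P

/-- The closed space-time cylinder `closure Ω × [0, T]` in `ℝ⁴`. -/
def cyl : Set E4 := {X | spc X ∈ closure D.Ω ∧ X 3 ∈ Icc 0 D.T}

end Data

/-! ### Harmonic and caloric potentials -/

/-- The fundamental solution `h₂(x) = 1 / (4 π |x|)` of the Laplacian on `ℝ³`. -/
def newton (x : E3) : ℝ := 1 / (4 * Real.pi * ‖x‖)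

/-- The heat kernel `h(x, s) = (2 √(π s))⁻³ exp(-|x|² / (4 s))` for `s > 0`, zero for `s ≤ 0`. -/
def heat (x : E3) (s : ℝ) : ℝ :=
  if 0 < s then 1 / (2 * Real.sqrt (Real.pi * s)) ^ 3 * Real.exp (-‖x‖ ^ 2 / (4 * s)) else 0

/-- The derivative `∇h(x, s) · v` of the heat kernel in the space direction `v`. -/
def dheat (x : E3) (s : ℝ) (v : E3) : ℝ := fderiv ℝ (fun y => heat y s) x v

namespace Data

variable (D : Data)

/-- The heat potential of an initial density `a` on `closure Ω`. -/
def heatInit (a : E3 → ℝ) (M : E3) (t : ℝ) : ℝ :=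
  ∫ P in closure D.Ω, heat (M - P) t * a P

/-- The single layer heat potential `h .∗_{∂Ω} a`. -/
def heatSingle (a : E3 → ℝ → ℝ) (M : E3) (t : ℝ) : ℝ :=
  ∫ s in (0 : ℝ)..D.T, ∫ P, heat (M - P) (t - s) * a P s ∂(surf D.Ω)

/-- The potential `∂h/∂n_{P₁} .∗_{∂Ω} a` with kernel `∇_M h(M - P₁, t - s) · n_{P₁}`,
`P₁` being the integration variable. -/
def heatDouble (a : E3 → ℝ → ℝ) (M : E3) (t : ℝ) : ℝ :=
  ∫ s in (0 : ℝ)..D.T, ∫ P, dheat (M - P) (t - s) (D.n P) * a P s ∂(surf D.Ω)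

/-- The potential `∂h/∂n_{P₀} .∗_{∂Ω} a` at `P₀ ∈ ∂Ω`, with kernel
`∇_M h(M - P₁, t - s) · n_{P₀}` at `M = P₀`. -/
def heatDoubleAdj (a : E3 → ℝ → ℝ) (P₀ : E3) (t : ℝ) : ℝ :=
  ∫ s in (0 : ℝ)..D.T, ∫ P, dheat (P₀ - P) (t - s) (D.n P₀) * a P s ∂(surf D.Ω)

/-- The volume heat potential `h .∗ f` of a source `f` on `closure Ω × [0, T]`. -/
def heatVol (f : E4 → ℝ) (M : E3) (t : ℝ) : ℝ :=
  ∫ s in (0 : ℝ)..D.T, ∫ P in closure D.Ω, heat (M - P) (t - s) * f (pt P s)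

/-- The normal derivative `∂h/∂n_{P₀} .∗ f` of the volume heat potential at `P₀ ∈ ∂Ω`. -/
def heatVolNormal (f : E4 → ℝ) (P₀ : E3) (t : ℝ) : ℝ :=
  ∫ s in (0 : ℝ)..D.T, ∫ P in closure D.Ω, dheat (P₀ - P) (t - s) (D.n P₀) * f (pt P s)

/-- The double layer potential `∫_{∂Ω} ∇h₂(M - P₁) · n_{P₁} a(P₁) dS`. -/
def newtonDouble (a : E3 → ℝ) (M : E3) : ℝ :=
  ∫ P, fderiv ℝ newton (M - P) (D.n P) * a P ∂(surf D.Ω)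

/-- The potential `∫_{∂Ω} ∇h₂(P₀ - P₁) · n_{P₀} a(P₁) dS` at `P₀ ∈ ∂Ω`. -/
def newtonDoubleAdj (a : E3 → ℝ) (P₀ : E3) : ℝ :=
  ∫ P, fderiv ℝ newton (P₀ - P) (D.n P₀) * a P ∂(surf D.Ω)

/-- `Γ` is a resolvent kernel for the singular Fredholm equation `φ/2 = g + K φ` on `∂Ω`, where
`K` is the double layer operator: whenever `g ∈ C(∂Ω)` is orthogonal to all continuous solutions
`a` of the homogeneous transposed equation `a/2 = -∂h₂/∂n_{P₀} .∗_{∂Ω} a` (the solvability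
condition), the function `φ = 2 (g + ∫ Γ(·, P₁) g(P₁) dS)` is a continuous solution. -/
def IsResolventKernel (Γ : E3 → E3 → ℝ) : Prop :=
  ∀ g : E3 → ℝ, ContinuousOn g (frontier D.Ω) →
    (∀ a : E3 → ℝ, ContinuousOn a (frontier D.Ω) →
      (∀ P ∈ frontier D.Ω, a P / 2 = -D.newtonDoubleAdj a P) →
      ∫ P, g P * a P ∂(surf D.Ω) = 0) →
    ∃ φ : E3 → ℝ, (∀ P, φ P = 2 * (g P + ∫ Q, Γ P Q * g Q ∂(surf D.Ω))) ∧
      ContinuousOn φ (frontier D.Ω) ∧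
      ∀ P ∈ frontier D.Ω, φ P / 2 = g P + D.newtonDouble φ P

end Data

/-- Regularity of the boundary data: `A₃ ∈ C²(∂Ω) ∩ C¹[0, T]` (Dirichlet),
`A₇ ∈ C¹(∂Ω × [0, T])` (Neumann), `A₈, σ ∈ C(∂Ω × [0, T])`, `σ > 0` (Robin).
Smoothness of a function on `∂Ω` means that it is the restriction of a smooth function. -/
def BdryCond.Regular (Ω : Set E3) (T : ℝ) : BdryCond → Prop
  | .dirichlet a₃ =>
      ContinuousOn (fun q : E3 × ℝ => a₃ q.1 q.2) (frontier Ω ×ˢ Icc 0 T) ∧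
      (∀ t ∈ Icc 0 T, ∃ G : E3 → Fin 3 → ℝ, ContDiff ℝ 2 G ∧
        EqOn G (fun P => a₃ P t) (frontier Ω)) ∧
      ∀ P ∈ frontier Ω, ContDiffOn ℝ 1 (a₃ P) (Icc 0 T)
  | .neumann a₇ =>
      ∃ G : E3 × ℝ → Fin 3 → ℝ, ContDiff ℝ 1 G ∧
        EqOn G (fun q => a₇ q.1 q.2) (frontier Ω ×ˢ Icc 0 T)
  | .robin a₈ σ =>
      ContinuousOn (fun q : E3 × ℝ => a₈ q.1 q.2) (frontier Ω ×ˢ Icc 0 T) ∧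
      ContinuousOn (fun q : E3 × ℝ => σ q.1 q.2) (frontier Ω ×ˢ Icc 0 T) ∧
      ∀ P ∈ frontier Ω, ∀ t ∈ Icc 0 T, 0 < σ P t

/-- The standing assumptions on the data. -/
structure Data.Admissible (D : Data) : Prop where
  isOpen : IsOpen D.Ω
  isConnected : IsConnected D.Ω
  isBounded : Bornology.IsBounded D.Ω
  convex : Convex ℝ (closure D.Ω)
  boundary : ∃ α : ℝ, 0 < α ∧ α ≤ 1 ∧ HasC1HolderBoundary D.Ω α
  T_pos : 0 < D.T
  μ_pos : 0 < D.μ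
  ρ_pos : 0 < D.ρ
  force : ContinuousOn D.F D.cyl
  initial : ContDiffOn ℝ 2 D.A₁ (closure D.Ω)
  bdry : D.bc.Regular D.Ω D.T
  resolvent : D.IsResolventKernel D.Γ₄

/-! ### The nonlinearities -/

namespace Data

variable (D : Data)

/-- `ψ(Z₁) = (μ - 1)(u_xx + u_yy + u_zz) - u₁ u_x - u₂ u_y - u₃ u_z + F`, where `∂ₓu₁` is
replaced by `-∂_y u₂ - ∂_z u₃`. -/
def ψ (Z : E4 → Idx → ℝ) (X : E4) (i : Fin 3) : ℝ :=
  (D.μ - 1) * (Z X (4, i) + Z X (7, i) + Z X (9, i))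
    - Z X (0, 0) * ![-Z X (2, 1) - Z X (3, 2), Z X (1, 1), Z X (1, 2)] i
    - Z X (0, 1) * Z X (2, i) - Z X (0, 2) * Z X (3, i) + D.F X i

/-- `ψ₁(Z₁) = -τ grad p + ψ(Z₁)`. -/
def ψ₁ (Z : E4 → Idx → ℝ) (X : E4) (i : Fin 3) : ℝ :=
  -D.τ * Z X (10, i) + D.ψ Z X i

end Data

/-! ### Fourier transform on space-time -/

/-- `F(f)(ξ) = ∫ f(X) e^{-i ξ·X} dX`. -/
def FT (f : E4 → ℂ) (ξ : E4) : ℂ :=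
  ∫ X, f X * Complex.exp (-Complex.I * ((inner ℝ ξ X : ℝ) : ℂ))

/-- `F⁻¹(g)(X) = (2π)⁻⁴ ∫ g(ξ) e^{i ξ·X} dξ`. -/
def invFT (g : E4 → ℂ) (X : E4) : ℂ :=
  (1 / (2 * (Real.pi : ℂ)) ^ 4) *
    ∫ ξ, g ξ * Complex.exp (Complex.I * ((inner ℝ ξ X : ℝ) : ℂ))

/-- The Gaussian mollifier `δ_ε(X) = (√(π ε))⁻⁴ e^{-|X|²/ε}`. -/
def gauss (ε : ℝ) (X : E4) : ℝ :=
  1 / Real.sqrt (Real.pi * ε) ^ 4 * Real.exp (-‖X‖ ^ 2 / ε)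

/-! ### The symbol matrices -/

/-- The symbol `i ξ_{j+1}` of `∂/∂x_{j+1}`, `j = 0, 1, 2`. -/
def sx (ξ : E4) (j : Fin 3) : ℂ := Complex.I * (ξ j.castSucc : ℂ)

/-- The symbol `i ξ₀` of `∂/∂t`. -/
def st (ξ : E4) : ℂ := Complex.I * (ξ 3 : ℂ)

/-- The `3 × 3` blocks of `B₁`. The block rows are the Fourier transforms of
`u_t = Δu - τ grad p + v`, of the definitions of `u_x` (with `∂ₓu₁ = -∂_y u₂ - ∂_z u₃`), `u_y`,
`u_z`, `u_xx`, `u_xy`, `u_xz`, `u_yy`, `u_yz`, `u_zz`, and of `grad p`. -/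
def B₁blk (τ : ℝ) (ξ : E4) : Matrix (Fin 11) (Fin 11) (Matrix (Fin 3) (Fin 3) ℂ) :=
  let E : Matrix (Fin 3) (Fin 3) ℂ := 1
  let F₁ : Matrix (Fin 3) (Fin 3) ℂ := !![0, 0, 0; 0, -1, 0; 0, 0, -1]
  let F₂ : Matrix (Fin 3) (Fin 3) ℂ := !![0, 1, 0; 0, 0, 0; 0, 0, 0]
  let F₃ : Matrix (Fin 3) (Fin 3) ℂ := !![0, 0, 1; 0, 0, 0; 0, 0, 0]
  let F₄ : Matrix (Fin 3) (Fin 3) ℂ := !![sx ξ 0, 0, 0; sx ξ 1, 0, 0; sx ξ 2, 0, 0]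
  !![st ξ • E, 0, 0, 0, -E, 0, 0, -E, 0, -E, (τ : ℂ) • E;
     sx ξ 0 • E, F₁, F₂, F₃, 0, 0, 0, 0, 0, 0, 0;
     sx ξ 1 • E, 0, -E, 0, 0, 0, 0, 0, 0, 0, 0;
     sx ξ 2 • E, 0, 0, -E, 0, 0, 0, 0, 0, 0, 0;
     (sx ξ 0 * sx ξ 0) • E, 0, 0, 0, -E, 0, 0, 0, 0, 0, 0;
     (sx ξ 0 * sx ξ 1) • E, 0, 0, 0, 0, -E, 0, 0, 0, 0, 0;
     (sx ξ 0 * sx ξ 2) • E, 0, 0, 0, 0, 0, -E, 0, 0, 0, 0;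
     (sx ξ 1 * sx ξ 1) • E, 0, 0, 0, 0, 0, 0, -E, 0, 0, 0;
     (sx ξ 1 * sx ξ 2) • E, 0, 0, 0, 0, 0, 0, 0, -E, 0, 0;
     (sx ξ 2 * sx ξ 2) • E, 0, 0, 0, 0, 0, 0, 0, 0, -E, 0;
     0, F₄, 0, 0, 0, 0, 0, 0, 0, 0, -E]

/-- The `33 × 33` matrix `B₁(ξ)`; it is invertible for almost every `ξ`. -/
def B₁ (τ : ℝ) (ξ : E4) : Matrix Idx Idx ℂ :=
  Matrix.of fun a b => B₁blk τ ξ a.1 b.1 a.2 b.2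

/-- The `33 × 3` matrix `B₂`, with the identity in the first block row and zeros below. -/
def B₂ : Matrix Idx (Fin 3) ℂ :=
  Matrix.of fun a j => if a.1 = 0 ∧ a.2 = j then 1 else 0

/-! ### Boundary data and the operators `T₀_ε` -/

/-- The boundary quantities `A₂ = u|_{t = T}`, `A₃ = u|_{∂Ω}`, `(A₄, A₅, A₆) = (u_x, u_y, u_z)|_{∂Ω}`
(here `grad 0, grad 1, grad 2`), `A₇ = ∂u/∂n|_{∂Ω}`, `A₉ = p|_{∂Ω}`. -/
structure BdryData where
  A₂ : E3 → Fin 3 → ℝ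
  A₃ : E3 → ℝ → Fin 3 → ℝ
  grad : Fin 3 → E3 → ℝ → Fin 3 → ℝ
  A₇ : E3 → ℝ → Fin 3 → ℝ
  A₉ : E3 → ℝ → ℝ

namespace Data

variable (D : Data)

/-- `∫₀ᵀ ∫_{∂Ω} a(P, t) e^{-i ξ·(P, t)} dS dt`. -/
def bdryFT (a : E3 → ℝ → ℝ) (ξ : E4) : ℂ :=
  ∫ t in (0 : ℝ)..D.T, ∫ P, (a P t : ℂ) *
    Complex.exp (-Complex.I * ((inner ℝ ξ (pt P t) : ℝ) : ℂ)) ∂(surf D.Ω)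

/-- `f₀ = ∫_{closure Ω} (A₂ e^{-i T ξ₀} - A₁) e^{-i (x ξ₁ + y ξ₂ + z ξ₃)} dx dy dz`. -/
def f₀ (A : BdryData) (ξ : E4) (i : Fin 3) : ℂ :=
  ∫ P in closure D.Ω,
    ((A.A₂ P i : ℂ) * Complex.exp (-Complex.I * D.T * ξ 3) - (D.A₁ P i : ℂ)) *
      Complex.exp (-Complex.I * ((inner ℝ ξ (pt P 0) : ℝ) : ℂ))

/-- `f_{j+1} = ∫₀ᵀ ∫_{∂Ω} A₃ n_{j+1} e^{-i ξ·X} dS dt`, `j = 0, 1, 2`. -/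
def f (A : BdryData) (j : Fin 3) (ξ : E4) (i : Fin 3) : ℂ :=
  D.bdryFT (fun P t => A.A₃ P t i * D.n P j) ξ

/-- `f_{(j+1)(k+1)} = ∫₀ᵀ ∫_{∂Ω} A_{j+4} n_{k+1} e^{-i ξ·X} dS dt`, `j, k = 0, 1, 2`. -/
def ff (A : BdryData) (j k : Fin 3) (ξ : E4) (i : Fin 3) : ℂ :=
  D.bdryFT (fun P t => A.grad j P t i * D.n P k) ξ

/-- `g_{j+1} = ∫₀ᵀ ∫_{∂Ω} A₉ n_{j+1} e^{-i ξ·X} dS dt`, `j = 0, 1, 2`. -/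
def g (A : BdryData) (j : Fin 3) (ξ : E4) : ℂ :=
  D.bdryFT (fun P t => A.A₉ P t * D.n P j) ξ

/-- The vector `β₁` collecting the boundary terms of the Fourier transforms over
`closure Ω × [0, T]` of the eleven block equations. -/
def β₁ (A : BdryData) (ξ : E4) (a : Idx) : ℂ :=
  (![fun i => -D.f₀ A ξ i,
     fun i => -D.f A 0 ξ i,
     fun i => -D.f A 1 ξ i,
     fun i => -D.f A 2 ξ i,
     fun i => -D.ff A 0 0 ξ i - sx ξ 0 * D.f A 0 ξ i,
     fun i => -D.ff A 1 0 ξ i - sx ξ 0 * D.f A 1 ξ i,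
     fun i => -D.ff A 2 0 ξ i - sx ξ 0 * D.f A 2 ξ i,
     fun i => -D.ff A 1 1 ξ i - sx ξ 1 * D.f A 1 ξ i,
     fun i => -D.ff A 2 1 ξ i - sx ξ 1 * D.f A 2 ξ i,
     fun i => -D.ff A 2 2 ξ i - sx ξ 2 * D.f A 2 ξ i,
     fun i => -D.g A i ξ] : Fin 11 → Fin 3 → ℂ) a.1 a.2

/-- `w_{1ε} = F⁻¹(F(δ_ε) B₁⁻¹ β₁)`. -/
def w₁ (ε : ℝ) (A : BdryData) (X : E4) (a : Idx) : ℂ :=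
  invFT (fun ξ => FT (fun Y => (gauss ε Y : ℂ)) ξ * ((B₁ D.τ ξ)⁻¹.mulVec (D.β₁ A ξ)) a) X

/-- `w_{2ε} = F⁻¹(F(δ_ε) B₁⁻¹ B₂)`. -/
def w₂ (ε : ℝ) (X : E4) (a : Idx) (j : Fin 3) : ℂ :=
  invFT (fun ξ => FT (fun Y => (gauss ε Y : ℂ)) ξ * ((B₁ D.τ ξ)⁻¹ * B₂) a j) X

/-- `T_{0ε}(Z₁) = w_{1ε} + w_{2ε} .∗ ψ(Z₁ I_{closure Ω × [0, T]})`, for given boundary data. -/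
def T₀ (ε : ℝ) (A : BdryData) (Z : E4 → Idx → ℝ) (X : E4) (a : Idx) : ℂ :=
  D.w₁ ε A X a + ∫ Y in D.cyl, ∑ j, D.w₂ ε (X - Y) a j * (D.ψ Z Y j : ℂ)

/-- The equations that determine the two traces `A₃`, `A₇` from the boundary condition, the
initial velocity and the source `ψ₁(Z₁)`.
* Dirichlet: `A₃` is given and `A₇` solves
  `A₇/2 = ∂h/∂n_{P₀} .∗_{∂Ω} A₇ + g₀₂ + ∂h/∂n_{P₀} .∗ ψ₁(Z₁)`, where `g₀₂` is the limit from inside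
  along the normal of the normal derivative of `h .∗ A₁ + ∂h/∂n_{P₁} .∗_{∂Ω} A₃`.
* Neumann: `A₇` is given and `A₃` solves
  `A₃/2 = ∂h/∂n_{P₁} .∗_{∂Ω} A₃ + g₀₄ + h .∗ ψ₁(Z₁)`, where `g₀₄` is the limit from inside of
  `h .∗ A₁ + h .∗_{∂Ω} A₇`.
* Robin: `A₇ = A₈ - σ A₃` and `A₃` solves
  `A₃/2 = -h .∗_{∂Ω} (σ A₃) + ∂h/∂n_{P₁} .∗_{∂Ω} A₃ + g₀₆ + h .∗ ψ₁(Z₁)`, where `g₀₆` is the limit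
  from inside of `h .∗ A₁ + h .∗_{∂Ω} A₈`. -/
def TraceEquations (Z : E4 → Idx → ℝ) (A₃ A₇ : E3 → ℝ → Fin 3 → ℝ) : BdryCond → Prop
  | .dirichlet a₃ =>
      (∀ P ∈ frontier D.Ω, ∀ t ∈ Icc 0 D.T, A₃ P t = a₃ P t) ∧
      ∃ g₀₂ : E3 → ℝ → Fin 3 → ℝ, ∀ P ∈ frontier D.Ω, ∀ t ∈ Ioc 0 D.T, ∀ i,
        Tendsto (fun r : ℝ => lineDeriv ℝ (fun M => D.heatInit (fun Q => D.A₁ Q i) M t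
            + D.heatDouble (fun Q s => A₃ Q s i) M t) (P - r • D.n P) (D.n P))
          (𝓝[>] 0) (𝓝 (g₀₂ P t i)) ∧
        A₇ P t i / 2 = D.heatDoubleAdj (fun Q s => A₇ Q s i) P t + g₀₂ P t i
          + D.heatVolNormal (fun Y => D.ψ₁ Z Y i) P t
  | .neumann a₇ =>
      (∀ P ∈ frontier D.Ω, ∀ t ∈ Icc 0 D.T, A₇ P t = a₇ P t) ∧
      ∃ g₀₄ : E3 → ℝ → Fin 3 → ℝ, ∀ P ∈ frontier D.Ω, ∀ t ∈ Ioc 0 D.T, ∀ i,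
        Tendsto (fun M => D.heatInit (fun Q => D.A₁ Q i) M t
            + D.heatSingle (fun Q s => A₇ Q s i) M t)
          (𝓝[D.Ω] P) (𝓝 (g₀₄ P t i)) ∧
        A₃ P t i / 2 = D.heatDouble (fun Q s => A₃ Q s i) P t + g₀₄ P t i
          + D.heatVol (fun Y => D.ψ₁ Z Y i) P t
  | .robin a₈ σ =>
      (∀ P ∈ frontier D.Ω, ∀ t ∈ Icc 0 D.T, ∀ i, A₇ P t i = a₈ P t i - σ P t * A₃ P t i) ∧
      ∃ g₀₆ : E3 → ℝ → Fin 3 → ℝ, ∀ P ∈ frontier D.Ω, ∀ t ∈ Ioc 0 D.T, ∀ i,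
        Tendsto (fun M => D.heatInit (fun Q => D.A₁ Q i) M t
            + D.heatSingle (fun Q s => a₈ Q s i) M t)
          (𝓝[D.Ω] P) (𝓝 (g₀₆ P t i)) ∧
        A₃ P t i / 2 = -D.heatSingle (fun Q s => σ Q s * A₃ Q s i) P t
          + D.heatDouble (fun Q s => A₃ Q s i) P t + g₀₆ P t i
          + D.heatVol (fun Y => D.ψ₁ Z Y i) P t

/-- The boundary pressure. `ψ₂` is the pressure component of `T₀(Z₁) = lim_{ε → 0} T_{0ε}(Z₁)`
inside `Ω × (0, T)` without the contribution of `A₉` (a double layer potential), i.e. computed with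
`A₉` replaced by zero; `ψ₃` is its limit on `∂Ω` from inside; and
`A₉/2 = ψ₃ + ∫_{∂Ω} Γ₄(·, P₁) ψ₃(P₁, t) dS + C₀`. -/
def PressureEquation (Z : E4 → Idx → ℝ) (A : BdryData) : Prop :=
  ∃ (ψ₂ ψ₃ : E3 → ℝ → ℝ),
    (∀ M ∈ D.Ω, ∀ t ∈ Ioo 0 D.T,
      Tendsto (fun ε => D.T₀ ε { A with A₉ := fun _ _ => 0 } Z (pt M t) (1, 0))
        (𝓝[>] 0) (𝓝 (ψ₂ M t : ℂ))) ∧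
    ContinuousOn (fun q : E3 × ℝ => ψ₃ q.1 q.2) (frontier D.Ω ×ˢ Icc 0 D.T) ∧
    (∀ P ∈ frontier D.Ω, ∀ t ∈ Ioo 0 D.T,
      Tendsto (fun M => ψ₂ M t) (𝓝[D.Ω] P) (𝓝 (ψ₃ P t))) ∧
    ∀ P ∈ frontier D.Ω, ∀ t ∈ Icc 0 D.T,
      A.A₉ P t / 2 = ψ₃ P t + (∫ Q, D.Γ₄ P Q * ψ₃ Q t ∂(surf D.Ω)) + D.C₀

/-- `A` is the boundary data associated with `Z₁`. -/
structure IsBdryData (Z : E4 → Idx → ℝ) (A : BdryData) : Prop where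
  continuous₃ : ContinuousOn (fun q : E3 × ℝ => A.A₃ q.1 q.2) (frontier D.Ω ×ˢ Icc 0 D.T)
  continuous₇ : ContinuousOn (fun q : E3 × ℝ => A.A₇ q.1 q.2) (frontier D.Ω ×ˢ Icc 0 D.T)
  trace : D.TraceEquations Z A.A₃ A.A₇ D.bc
  /-- `A₂ = h .∗ A₁ + h .∗_{∂Ω} A₇ + ∂h/∂n_{P₁} .∗_{∂Ω} A₃ + h .∗ ψ₁(Z₁)` at `t = T`, on `Ω` -/
  final : ∀ M ∈ D.Ω, ∀ i, A.A₂ M i =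
    D.heatInit (fun Q => D.A₁ Q i) M D.T + D.heatSingle (fun Q s => A.A₇ Q s i) M D.T
      + D.heatDouble (fun Q s => A.A₃ Q s i) M D.T + D.heatVol (fun Y => D.ψ₁ Z Y i) M D.T
  differentiable : ∀ P ∈ frontier D.Ω, ∀ t ∈ Icc 0 D.T,
    DifferentiableWithinAt ℝ (fun Q => A.A₃ Q t) (frontier D.Ω) P
  /-- `A_{j+4} = ∂A₃/∂x_{j+1} + (A₇ - ∂A₃/∂n) n_{j+1}`; only derivatives of `A₃` along the tangent
  vector `e_j - n_j n` to `∂Ω` enter -/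
  gradient : ∀ j, ∀ P ∈ frontier D.Ω, ∀ t ∈ Icc 0 D.T, ∀ i, A.grad j P t i =
    fderivWithin ℝ (fun Q => A.A₃ Q t) (frontier D.Ω) P
        (EuclideanSpace.single j (1 : ℝ) - D.n P j • D.n P) i
      + A.A₇ P t i * D.n P j
  pressure : D.PressureEquation Z A

/-- `Z₁ = T_{0ε}(Z₁)` on `closure Ω × [0, T]`. -/
def IsFixedPoint (ε : ℝ) (Z : E4 → Idx → ℝ) : Prop :=
  ∃ A : BdryData, D.IsBdryData Z A ∧ ∀ X ∈ D.cyl, ∀ a, (Z X a : ℂ) = D.T₀ ε A Z X a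

/-- The ball `Ω_M = {Z₁ ∈ C(closure Ω × [0, T]) : ‖Z₁‖_∞ < M}`. The norm is the maximum of the
`|Z_{1,i}(X)|` over the compact cylinder and the 33 components. -/
def ball (M : ℝ) : Set (E4 → Idx → ℝ) :=
  {Z | ContinuousOn Z D.cyl ∧ ∀ X ∈ D.cyl, ∀ a, |Z X a| < M}

/-- There are `ε_k > 0`, `ε_k → 0`, and `Z_{1ε_k} ∈ Ω_M` with `Z_{1ε_k} = T_{0ε_k}(Z_{1ε_k})` such
that `lim Z_{1ε_k}` exists almost everywhere on `closure Ω × [0, T]`. -/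
def ConvergenceCondition (M : ℝ) : Prop :=
  ∃ (ε : ℕ → ℝ) (Z : ℕ → E4 → Idx → ℝ),
    (∀ k, 0 < ε k) ∧ (∀ k, Z k ∈ D.ball M) ∧ (∀ k, D.IsFixedPoint (ε k) (Z k)) ∧
    Tendsto ε atTop (𝓝 0) ∧
    ∀ᵐ X ∂(volume.restrict D.cyl), ∃ z : Idx → ℝ, Tendsto (fun k => Z k X) atTop (𝓝 z)

/-- `Ω⁺ = {X ∈ closure Ω × [0, T] : Z_i(X) - W_i(X) ≥ 0}`. -/
def posSet (Z W : E4 → Idx → ℝ) (i : Idx) : Set E4 := {X ∈ D.cyl | Z X i - W X i ≥ 0}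

/-- `Ω⁻ = {X ∈ closure Ω × [0, T] : Z_i(X) - W_i(X) < 0}`. -/
def negSet (Z W : E4 → Idx → ℝ) (i : Idx) : Set E4 := {X ∈ D.cyl | Z X i - W X i < 0}

/-- `{X ∈ closure Ω × [0, T] : dist(X, ∂S) ≤ d}`, with the boundary and the Euclidean distance taken
in `ℝ⁴`, and `dist(X, ∅) = ∞`. -/
def bdryNhd (S : Set E4) (d : ℝ) : Set E4 := D.cyl ∩ Metric.cthickening d (frontier S)

end Data

end

end NavierStokes

/-! Bounded sequences have weakly convergent subsequences, and only oscillation separates weak from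
almost everywhere convergence. The hypothesis on the sets `{Z k ≥ Z l}` excludes such oscillation.

Cut the compact cylinder `K` into small pieces and let `g` be a component of `Z k - Z l`. On a piece
where `g` keeps one sign, `∫ |g|` equals `|∫ g|`. A piece where the sign changes lies in a small
ball that meets both `{g ≥ 0}` and its complement. The ball is connected, so it meets the frontier
of `{g ≥ 0}`, and the whole piece is within one diameter of that frontier. By hypothesis such pieces
have small total measure, uniformly in `k` and `l`, and `|g| ≤ 2M` there. Hence the `L¹` norm of `g`
is bounded by finitely many integrals over pieces plus a uniformly small error
(`setIntegral_abs_le_sum`).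

By compactness, one subsequence makes the integrals over all pieces, at all scales, converge
(`exists_subseq_tendsto_setIntegral`). Along it the sequence is Cauchy in `L¹`, so a further
subsequence converges almost everywhere. Fixed points and the ball `Ω_M` are kept by passing to
subsequences. -/

/-! ### Sign changes and frontiers -/

/-- A preconnected set that meets both `S` and its complement meets the frontier of `S`. -/
theorem IsPreconnected.exists_mem_frontier {X : Type*} [TopologicalSpace X] {C S : Set X}
    (hC : IsPreconnected C) {x y : X} (hx : x ∈ C) (hxS : x ∈ S) (hy : y ∈ C) (hyS : y ∉ S) :
    ∃ z ∈ C, z ∈ frontier S := by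
  by_contra! hne
  have hcover : C ⊆ interior S ∪ (closure S)ᶜ := fun z hz => by
    by_contra hz'
    simp only [mem_union, mem_compl_iff, not_or, not_not] at hz'
    exact hne z hz ⟨hz'.2, hz'.1⟩
  have hdisj : Disjoint (interior S) (closure S)ᶜ :=
    disjoint_compl_right.mono_left (interior_subset.trans subset_closure)
  have hxI : x ∈ interior S := by
    by_contra hxI
    exact hne x hx ⟨subset_closure hxS, hxI⟩
  have hsub := hC.subset_left_of_subset_union isOpen_interior isClosed_closure.isOpen_compl
    hdisj hcover ⟨x, hx, hxI⟩
  exact hyS (interior_subset (hsub hy))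

/-- A subset of a ball of diameter at most `d` that meets both `S` and its complement lies within
distance `d` of the frontier of `S`. -/
theorem subset_cthickening_frontier {E : Type*} [NormedAddCommGroup E] [NormedSpace ℝ E]
    {P S : Set E} {a : E} {r d : ℝ} (hP : P ⊆ Metric.ball a r) (hrd : 2 * r ≤ d) {x y : E}
    (hx : x ∈ P) (hxS : x ∈ S) (hy : y ∈ P) (hyS : y ∉ S) :
    P ⊆ Metric.cthickening d (frontier S) := by
  -- Connectedness is used for the ball, since `P` itself may be disconnected. The frontier point
  -- `z` may therefore lie outside `P`, but it stays within `2 * r` of every point of `P`.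
  obtain ⟨z, hz, hzS⟩ := (convex_ball a r).isPreconnected.exists_mem_frontier
    (hP hx) hxS (hP hy) hyS
  intro p hp
  refine Metric.mem_cthickening_of_dist_le p z d _ hzS ?_
  have h1 := Metric.mem_ball.1 (hP hp)
  have h2 := Metric.mem_ball'.1 hz
  linarith [dist_triangle p a z]

/-! ### Countable partitions into small pieces -/

section Partition

variable (E : Type*) [NormedAddCommGroup E] [TopologicalSpace.SeparableSpace E]

/-- A countable measurable partition of a separable normed space into sets contained in balls of
radius `1 / (m + 1)`. -/
noncomputable def smallPiece (m n : ℕ) : Set E :=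
  disjointed (fun j => Metric.ball (TopologicalSpace.denseSeq E j) (1 / ((m : ℝ) + 1))) n

theorem smallPiece_subset_ball (m n : ℕ) :
    smallPiece E m n ⊆ Metric.ball (TopologicalSpace.denseSeq E n) (1 / ((m : ℝ) + 1)) :=
  disjointed_subset _ n

theorem measurableSet_smallPiece [MeasurableSpace E] [BorelSpace E] (m n : ℕ) :
    MeasurableSet (smallPiece E m n) :=
  MeasurableSet.disjointed (fun _ => measurableSet_ball) n

theorem pairwise_disjoint_smallPiece (m : ℕ) : Pairwise (Function.onFun Disjoint (smallPiece E m)) :=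
  disjoint_disjointed _

variable {E}

/-- A compact set is covered by finitely many of the pieces. -/
theorem IsCompact.exists_biUnion_smallPiece {K : Set E} (hK : IsCompact K) (m : ℕ) :
    ∃ t : Finset ℕ, K = ⋃ n ∈ t, smallPiece E m n ∩ K := by
  have hr : (0 : ℝ) < 1 / ((m : ℝ) + 1) := Nat.one_div_pos_of_nat
  obtain ⟨t, ht⟩ := hK.elim_finite_subcover
    (fun j => Metric.ball (TopologicalSpace.denseSeq E j) (1 / ((m : ℝ) + 1)))
    (fun _ => Metric.isOpen_ball) fun x _ => by
      obtain ⟨j, hj⟩ := (TopologicalSpace.denseRange_denseSeq E).exists_dist_lt x hr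
      exact mem_iUnion.2 ⟨j, hj⟩
  -- A point of the `j`-th ball may belong to a piece of smaller index, so all indices up to the
  -- largest one in `t` are kept.
  refine ⟨Finset.range (t.sup id + 1), subset_antisymm (fun x hx => ?_) (by simp)⟩
  obtain ⟨j, hj, hxj⟩ := mem_iUnion₂.1 (ht hx)
  have hmem : x ∈ ⋃ n ∈ Finset.range (t.sup id + 1), smallPiece E m n := by
    rw [show (⋃ n ∈ Finset.range (t.sup id + 1), smallPiece E m n) = _ from
      biUnion_range_succ_disjointed _ _]
    exact le_partialSups_of_le
      (fun j => Metric.ball (TopologicalSpace.denseSeq E j) (1 / ((m : ℝ) + 1)))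
      (Finset.le_sup (f := id) hj) hxj
  obtain ⟨n, hn, hxn⟩ := mem_iUnion₂.1 hmem
  exact mem_iUnion₂.2 ⟨n, hn, hxn, hx⟩

end Partition

/-! ### `L¹` norms controlled by integrals over pieces -/

/-- On a set `P` contained in a small ball, the `L¹` norm of a bounded function `g` is at most the
absolute value of its integral, up to the contribution of a neighbourhood of the frontier of
`{g ≥ 0}`. -/
theorem setIntegral_abs_le_abs_setIntegral_add {E : Type*} [NormedAddCommGroup E]
    [NormedSpace ℝ E] [MeasurableSpace E] [BorelSpace E] {μ : Measure E} {K P : Set E} {g : E → ℝ}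
    {C d r : ℝ} {a : E} (hμ : μ K ≠ ⊤) (hK : MeasurableSet K) (hP : MeasurableSet P) (hPK : P ⊆ K)
    (hball : P ⊆ Metric.ball a r) (hrd : 2 * r ≤ d) (hg : IntegrableOn g K μ)
    (hC : ∀ x ∈ K, |g x| ≤ C) :
    ∫ x in P, |g x| ∂μ ≤ |∫ x in P, g x ∂μ| +
      ∫ x in P, (K ∩ Metric.cthickening d (frontier {x ∈ K | 0 ≤ g x})).indicator
        (fun _ => C) x ∂μ := by
  have hgP : IntegrableOn g P μ := hg.mono_set hPK
  have hμP : μ P ≠ ⊤ := ne_top_of_le_ne_top hμ (measure_mono hPK)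
  have hBmeas : MeasurableSet (K ∩ Metric.cthickening d (frontier {x ∈ K | 0 ≤ g x})) :=
    hK.inter Metric.isClosed_cthickening.measurableSet
  -- The error term can be dropped when `g` has constant sign on `P`. The sign of `C` is not
  -- assumed; where the indicator is nonzero, it follows from `|g| ≤ C`.
  have hnonneg : 0 ≤ ∫ x in P, (K ∩ Metric.cthickening d
      (frontier {x ∈ K | 0 ≤ g x})).indicator (fun _ => C) x ∂μ := by
    refine integral_nonneg fun x => indicator_nonneg (fun y hy => ?_) x
    exact (abs_nonneg _).trans (hC y hy.1)
  by_cases hpos : ∀ x ∈ P, 0 ≤ g x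
  · rw [setIntegral_congr_fun hP fun x hx => abs_of_nonneg (hpos x hx)]
    linarith [le_abs_self (∫ x in P, g x ∂μ)]
  by_cases hneg : ∀ x ∈ P, g x < 0
  · rw [setIntegral_congr_fun hP fun x hx => abs_of_neg (hneg x hx), integral_neg]
    linarith [neg_le_abs (∫ x in P, g x ∂μ)]
  push Not at hpos hneg
  obtain ⟨y, hy, hyg⟩ := hpos
  obtain ⟨x, hx, hxg⟩ := hneg
  -- Here `g` changes sign on `P`, so `P` lies entirely in the thickened frontier and the indicator
  -- equals `C` on all of `P`.
  have hsub := subset_cthickening_frontier (S := {x ∈ K | 0 ≤ g x}) hball hrd hx ⟨hPK hx, hxg⟩ hy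
    fun hy' => hyg.not_ge hy'.2
  have hle : ∫ x in P, |g x| ∂μ ≤ ∫ x in P, (K ∩ Metric.cthickening d
      (frontier {x ∈ K | 0 ≤ g x})).indicator (fun _ => C) x ∂μ := by
    refine setIntegral_mono_on hgP.abs ?_ hP fun z hz => ?_
    · exact (integrableOn_const hμP).indicator hBmeas
    · rw [indicator_of_mem (mem_inter (hPK hz) (hsub hz))]
      exact hC z (hPK hz)
  linarith [abs_nonneg (∫ x in P, g x ∂μ)]

/-- The `L¹` norm of a bounded function on a compact set is controlled by finitely many of its
averages, up to the measure of a neighbourhood of the frontier of `{g ≥ 0}`. -/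
theorem setIntegral_abs_le_sum {E : Type*} [NormedAddCommGroup E] [NormedSpace ℝ E]
    [TopologicalSpace.SeparableSpace E] [MeasurableSpace E] [BorelSpace E] {μ : Measure E}
    {K : Set E} {g : E → ℝ} {C c d : ℝ} {m : ℕ} {t : Finset ℕ} (hμ : μ K ≠ ⊤)
    (hK : MeasurableSet K) (hmd : 2 * (1 / ((m : ℝ) + 1)) ≤ d)
    (ht : K = ⋃ n ∈ t, smallPiece E m n ∩ K) (hg : IntegrableOn g K μ) (hC0 : 0 ≤ C)
    (hC : ∀ x ∈ K, |g x| ≤ C) (hc0 : 0 ≤ c)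
    (hc : μ (K ∩ Metric.cthickening d (frontier {x ∈ K | 0 ≤ g x})) ≤ ENNReal.ofReal c) :
    ∫ x in K, |g x| ∂μ ≤ ∑ n ∈ t, |∫ x in smallPiece E m n ∩ K, g x ∂μ| + c * C := by
  set B := K ∩ Metric.cthickening d (frontier {x ∈ K | 0 ≤ g x})
  have hBmeas : MeasurableSet B := hK.inter Metric.isClosed_cthickening.measurableSet
  have hPmeas : ∀ n ∈ t, MeasurableSet (smallPiece E m n ∩ K) := fun n _ =>
    (measurableSet_smallPiece E m n).inter hK
  have hdisj : (t : Set ℕ).Pairwise (Function.onFun Disjoint fun n => smallPiece E m n ∩ K) :=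
    fun i _ j _ hij => (pairwise_disjoint_smallPiece E m hij).mono inter_subset_left
      inter_subset_left
  have hsplit : ∀ u : E → ℝ, IntegrableOn u K μ →
      ∫ x in K, u x ∂μ = ∑ n ∈ t, ∫ x in smallPiece E m n ∩ K, u x ∂μ := fun u hu =>
    (congrArg (fun s => ∫ x in s, u x ∂μ) ht).trans
      (integral_biUnion_finset t hPmeas hdisj fun n _ => hu.mono_set inter_subset_right)
  have hind : IntegrableOn (B.indicator fun _ => C) K μ :=
    (integrableOn_const hμ).indicator hBmeas
  have hBint : ∫ x in K, B.indicator (fun _ => C) x ∂μ ≤ c * C := by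
    rw [setIntegral_indicator hBmeas, setIntegral_const, smul_eq_mul]
    refine mul_le_mul_of_nonneg_right ?_ hC0
    refine ENNReal.toReal_le_of_le_ofReal hc0 (le_trans (measure_mono inter_subset_right) hc)
  rw [hsplit _ hg.abs]
  -- The error terms of the pieces reassemble into a single integral over `K`, so the number of
  -- pieces does not enter the error `c * C`.
  calc ∑ n ∈ t, ∫ x in smallPiece E m n ∩ K, |g x| ∂μ
      ≤ ∑ n ∈ t, (|∫ x in smallPiece E m n ∩ K, g x ∂μ| +
          ∫ x in smallPiece E m n ∩ K, B.indicator (fun _ => C) x ∂μ) :=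
        Finset.sum_le_sum fun n hn => setIntegral_abs_le_abs_setIntegral_add hμ hK (hPmeas n hn)
          inter_subset_right (inter_subset_left.trans (smallPiece_subset_ball E m n)) hmd hg hC
    _ ≤ _ := by
        rw [Finset.sum_add_distrib, ← hsplit _ hind]
        linarith

/-! ### Extraction of subsequences -/

/-- A uniformly bounded sequence of real functions on a set of finite measure has a subsequence
whose integrals over countably many given subsets all converge. -/
theorem exists_subseq_tendsto_setIntegral {E J : Type*} [MeasurableSpace E] [Countable J]
    {μ : Measure E} {K : Set E} (hμ : μ K ≠ ⊤) {f : J → ℕ → E → ℝ} {M : ℝ}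
    (hM : ∀ j k, ∀ x ∈ K, |f j k x| ≤ M) {P : J → Set E} (hP : ∀ j, P j ⊆ K) :
    ∃ φ : ℕ → ℕ, StrictMono φ ∧
      ∀ j, ∃ l, Tendsto (fun k => ∫ x in P j, f j (φ k) x ∂μ) atTop (𝓝 l) := by
  -- The integrals form a sequence in a product of compact intervals. As `J` is countable, this
  -- product is sequentially compact, which replaces a diagonal argument.
  have hmem : ∀ k, (fun j => ∫ x in P j, f j k x ∂μ) ∈
      Set.univ.pi fun j => Icc (-(M * μ.real (P j))) (M * μ.real (P j)) := fun k j _ =>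
    abs_le.1 (norm_setIntegral_le_of_norm_le_const (f := f j k)
      (ne_top_of_le_ne_top hμ (measure_mono (hP j))).lt_top fun x hx => hM j k x (hP j hx))
  obtain ⟨l, -, φ, hφ, hl⟩ := (isCompact_univ_pi fun _ => isCompact_Icc).tendsto_subseq hmem
  exact ⟨φ, hφ, fun j => ⟨l j, (tendsto_pi_nhds.1 hl) j⟩⟩

/-- A sequence of families of functions that is Cauchy in `L¹` has a subsequence converging almost
everywhere. -/
theorem exists_subseq_tendsto_ae_of_cauchy {E ι : Type*} [Finite ι] [MeasurableSpace E]
    {μ : Measure E} {f : ℕ → ι → E → ℝ} (hf : ∀ k i, Integrable (f k i) μ)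
    (hcau : ∀ η > 0, ∃ N, ∀ k ≥ N, ∀ l ≥ N, ∀ i, ∫ x, |f k i x - f l i x| ∂μ < η) :
    ∃ φ : ℕ → ℕ, StrictMono φ ∧
      ∀ᵐ x ∂μ, ∀ i, ∃ z, Tendsto (fun k => f (φ k) i x) atTop (𝓝 z) := by
  -- Along a subsequence with `φ n ≥ N n`, the `L¹` distances beyond index `n` are below the
  -- summable bounds `(1 / 2) ^ n`, which forces almost everywhere convergence. `N` is uniform in
  -- `i`, so one `φ` serves all components.
  choose N hN using fun n : ℕ => hcau ((1 / 2 : ℝ) ^ n) (by positivity)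
  obtain ⟨φ, hφ, hφN⟩ : ∃ φ : ℕ → ℕ, StrictMono φ ∧ ∀ n, N n ≤ φ n :=
    extraction_forall_of_eventually' fun n => ⟨N n, fun k hk => hk⟩
  refine ⟨φ, hφ, ae_all_iff.2 fun i => ?_⟩
  refine Lp.ae_tendsto_of_cauchy_eLpNorm (p := 1) (B := fun n => ENNReal.ofReal ((1 / 2 : ℝ) ^ n))
    (fun n => (hf _ i).aestronglyMeasurable) le_rfl ?_ fun n k l hk hl => ?_
  · rw [← ENNReal.ofReal_tsum_of_nonneg (fun n => by positivity) summable_geometric_two]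
    exact ENNReal.ofReal_ne_top
  · rw [eLpNorm_one_eq_lintegral_enorm, ← ofReal_integral_norm_eq_lintegral_enorm
      ((hf _ i).sub (hf _ i)), ENNReal.ofReal_lt_ofReal_iff (by positivity)]
    exact hN n _ ((hφN n).trans (hφ.monotone hk)) _ ((hφN n).trans (hφ.monotone hl)) i

/-- A uniformly bounded sequence of families of integrable functions on a compact set, for which the
neighbourhoods of the frontiers of the sets `{f k i ≥ f l i}` are uniformly small in measure, has a
subsequence converging almost everywhere. -/
theorem exists_subseq_tendsto_ae_of_frontier_small {E ι : Type*} [NormedAddCommGroup E]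
    [NormedSpace ℝ E] [TopologicalSpace.SeparableSpace E] [MeasurableSpace E] [BorelSpace E]
    [Finite ι] {μ : Measure E} {K : Set E} (hK : IsCompact K) (hμ : μ K ≠ ⊤)
    {f : ℕ → ι → E → ℝ} {M : ℝ} (hM0 : 0 < M) (hf : ∀ k i, IntegrableOn (f k i) K μ)
    (hM : ∀ k i, ∀ x ∈ K, |f k i x| ≤ M)
    (hsmall : ∀ c > 0, ∃ d > 0, ∀ k l i,
      μ (K ∩ Metric.cthickening d (frontier {x ∈ K | 0 ≤ f k i x - f l i x}))
        ≤ ENNReal.ofReal c) :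
    ∃ φ : ℕ → ℕ, StrictMono φ ∧
      ∀ᵐ x ∂(μ.restrict K), ∀ i, ∃ z, Tendsto (fun k => f (φ k) i x) atTop (𝓝 z) := by
  -- The index set runs over component, scale and piece: `φ` must be fixed before `η` determines the
  -- scale.
  obtain ⟨φ, hφ, hlim⟩ := exists_subseq_tendsto_setIntegral (J := ι × ℕ × ℕ) hμ
    (f := fun j k => f k j.1) (M := M) (fun j k => hM k j.1)
    (P := fun j => smallPiece E j.2.1 j.2.2 ∩ K) fun _ => inter_subset_right
  have hcau : ∀ η > 0, ∃ N, ∀ k ≥ N, ∀ l ≥ N, ∀ i,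
      ∫ x in K, |f (φ k) i x - f (φ l) i x| ∂μ < η := by
    intro η hη
    -- Differences are bounded by `2 * M`, so this measure bound makes the frontier contribute at
    -- most `η / 2`; the other half is left for the integrals over pieces.
    have hc : 0 < η / (4 * M) := by positivity
    obtain ⟨d, hd, hsm⟩ := hsmall _ hc
    obtain ⟨m, hm⟩ := exists_nat_one_div_lt (half_pos hd)
    obtain ⟨t, ht⟩ := hK.exists_biUnion_smallPiece m
    -- At a fixed scale only finitely many pieces occur, and on each both integrals tend to the same
    -- limit as `k` and `l` grow independently.
    have hev : ∀ᶠ p : ℕ × ℕ in atTop, ∀ i,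
        ∑ n ∈ t, |∫ x in smallPiece E m n ∩ K, (f (φ p.1) i x - f (φ p.2) i x) ∂μ| < η / 2 := by
      refine eventually_all.2 fun i => ?_
      have htend : Tendsto (fun p : ℕ × ℕ => ∑ n ∈ t,
          |∫ x in smallPiece E m n ∩ K, (f (φ p.1) i x - f (φ p.2) i x) ∂μ|) atTop (𝓝 0) := by
        rw [← Finset.sum_const_zero (s := t)]
        refine tendsto_finsetSum t fun n _ => ?_
        obtain ⟨l, hl⟩ := hlim (i, m, n)
        simp only at hl
        simp_rw [fun p : ℕ × ℕ => integral_sub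
          (((hf (φ p.1) i).mono_set inter_subset_right : IntegrableOn _ (smallPiece E m n ∩ K) μ))
          ((hf (φ p.2) i).mono_set inter_subset_right : IntegrableOn _ (smallPiece E m n ∩ K) μ)]
        rw [← prod_atTop_atTop_eq]
        simpa using ((hl.comp tendsto_fst).sub (hl.comp tendsto_snd)).abs
      exact htend.eventually_lt_const (half_pos hη)
    obtain ⟨⟨N₁, N₂⟩, hN⟩ := eventually_atTop.1 hev
    refine ⟨max N₁ N₂, fun k hk l hl i => ?_⟩
    have hsum := hN (k, l) ⟨(le_max_left _ _).trans hk, (le_max_right _ _).trans hl⟩ i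
    have hle := setIntegral_abs_le_sum (C := 2 * M) hμ hK.measurableSet (by linarith) ht
      ((hf (φ k) i).sub (hf (φ l) i)) (by positivity)
      (fun x hx => (abs_sub _ _).trans (by linarith [hM (φ k) i x hx, hM (φ l) i x hx]))
      hc.le (hsm (φ k) (φ l) i)
    have hcalc : η / (4 * M) * (2 * M) = η / 2 := by
      field_simp
      norm_num
    simp only [Pi.sub_apply] at hle
    linarith
  obtain ⟨χ, hχ, hae⟩ := exists_subseq_tendsto_ae_of_cauchy (fun k i => hf (φ k) i) hcau
  exact ⟨φ ∘ χ, hφ.comp hχ, hae⟩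

/-! ### Application to the space-time cylinder -/

namespace NavierStokes

/-- The cylinder is the image of the compact product `closure Ω × [0, T]` under the continuous map
`pt`. Compactness supplies finite measure, integrability of continuous functions and finite covers
by pieces. -/
theorem Data.isCompact_cyl (D : Data) (hD : Bornology.IsBounded D.Ω) : IsCompact D.cyl := by
  have hspc : Continuous spc := by
    unfold spc
    refine (PiLp.continuous_toLp 2 _).comp (continuous_pi fun i => ?_)
    fin_cases i <;> simp <;> fun_prop
  have hpt : Continuous fun q : E3 × ℝ => pt q.1 q.2 := by
    unfold pt
    refine (PiLp.continuous_toLp 2 _).comp (continuous_pi fun i => ?_)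
    fin_cases i <;> simp <;> fun_prop
  have himg : D.cyl = (fun q : E3 × ℝ => pt q.1 q.2) '' (closure D.Ω ×ˢ Icc 0 D.T) := by
    ext X
    constructor
    · rintro ⟨h1, h2⟩
      refine ⟨(spc X, X 3), ⟨h1, h2⟩, ?_⟩
      ext i
      fin_cases i <;> simp [pt, spc]
    · rintro ⟨⟨P, t⟩, ⟨h1, h2⟩, rfl⟩
      have hP : spc (pt P t) = P := by
        ext i
        fin_cases i <;> simp [pt, spc]
      exact ⟨by rw [hP]; exact h1, by simpa [pt] using h2⟩
  rw [himg]
  exact (hD.isCompact_closure.prod isCompact_Icc).image hpt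

end NavierStokes

theorem theorem4p4 (D : NavierStokes.Data) (hD : D.Admissible) (M : ℝ) (hM : 0 < M)
    (h : ∃ (ε : ℕ → ℝ) (Z : ℕ → NavierStokes.E4 → NavierStokes.Idx → ℝ),
      (∀ k, 0 < ε k) ∧ Tendsto ε atTop (𝓝 0) ∧
      (∀ k, Z k ∈ D.ball M) ∧ (∀ k, D.IsFixedPoint (ε k) (Z k)) ∧
      ∀ c > 0, ∃ d > 0, ∀ (k l : ℕ) (i : NavierStokes.Idx),
        volume (D.bdryNhd (D.posSet (Z k) (Z l) i) d ∪ D.bdryNhd (D.negSet (Z k) (Z l) i) d)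
          ≤ ENNReal.ofReal c) :
    D.ConvergenceCondition M := by
  obtain ⟨ε, Z, hε, hε0, hZ, hfix, hsmall⟩ := h
  have hK := D.isCompact_cyl hD.isBounded
  obtain ⟨φ, hφ, hae⟩ := exists_subseq_tendsto_ae_of_frontier_small (μ := volume) hK
    hK.measure_lt_top.ne (f := fun k i X => Z k X i) hM
    (fun k i => (continuousOn_pi.1 (hZ k).1 i).integrableOn_compact hK)
    (fun k i X hX => ((hZ k).2 X hX i).le)
    (fun c hc => by
      obtain ⟨d, hd, hsm⟩ := hsmall c hc
      -- The frontier of the set where the difference is nonnegative already detects every sign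
      -- change.
      exact ⟨d, hd, fun k l i => (measure_mono subset_union_left).trans (hsm k l i)⟩)
  refine ⟨ε ∘ φ, Z ∘ φ, fun k => hε _, fun k => hZ _, fun k => hfix _,
    hε0.comp hφ.tendsto_atTop, ?_⟩
  filter_upwards [hae] with X hX
  choose z hz using hX
  exact ⟨z, tendsto_pi_nhds.2 hz⟩
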